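/- Let $\mathbb X=U/K$ be a rank-one Riemannian symmetric space of compact type (the circle included): $U$ is a compact Lie group with Lie algebra $\mathfrak u$, $\theta$ is an involutive automorphism of $U$, $K$ is a closed subgroup with $(U^\theta)_0\subseteq K\subseteq U^\theta$, $\mathbb X$ is connected and carries a $U$-invariant Riemannian metric, given by an $\mathrm{Ad}(K)$-invariant inner product on $\mathfrak q=\{X\in\mathfrak u: d\theta X=-X\}\cong T_{eK}\mathbb X$, and the maximal abelian subspaces of $\mathfrak q$ have dimension one. Equip $\mathbb X$ with the push-forward of the normalized Haar measure of $U$, let $\Delta$ be the Laplace–Beltrami operator of $\mathbb X$, and for $r\ge 0$ let $P_r$ be the orthogonal projection of $L^2(\mathbb X)$ onto $\ker(\Delta+r^2)$. For $f\in C^\infty(\mathbb X)$, $\psi:[0,\infty)\to\mathbb R$, $t\in\mathbb R$ and $\alpha\ge 0$ put $$e^{-it\psi(\sqrt{-\Delta})}f=\sum_{r} e^{-it\psi(r)}P_rf,\qquad \|f\|_{H^\alpha(\mathbb X)}=\Big(\sum_{r}(1+r^2)^{\alpha}\,\|P_rf\|_{L^2(\mathbb X)}^2\Big)^{1/2},$$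 the sums being over the (discrete) spectrum of $\sqrt{-\Delta}$. Functions on $\mathbb X$ are identified with right $K$-invariant functions on $U$; such a function is called $K$-biinvariant if it is also left $K$-invariant. For $p\in[1,\infty]$ and $\alpha>0$, say that the maximal estimate $M(\psi,p,\alpha)$ holds if there is a constant $C>0$ such that $$\Big\|\sup_{0\le t<2\pi}\big|e^{-it\psi(\sqrt{-\Delta})}f\big|\Big\|_{L^p(\mathbb X)}\le C\,\|f\|_{H^\alpha(\mathbb X)}\qquad\text{for all $K$-biinvariant } f\in C^\infty(\mathbb X).$$ **Theorem.** Let $\psi_1,\psi_2:[0,\infty)\to\mathbb R$ be continuous and suppose that there exist $R>0$ and $C>0$ with $|\psi_1(r)-\psi_2(r)|\le C$ for all $r>R$. Then for every $\alpha_0>0$ and every $p\in[1,\infty]$: if $M(\psi_1,p,\alpha)$ holds for all $\alpha>\alpha_0$, then $M(\psi_2,p,\alpha)$ holds for all $\alpha>\alpha_0$; and likewise with the roles of $\psi_1$ and $\psi_2$ interchanged. -/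

import Mathlib

open scoped Manifold ContDiff ENNReal NNReal
open MeasureTheory

noncomputable section

namespace SymmSpace

variable {E : Type*} [NormedAddCommGroup E] [NormedSpace ℝ E]
  {U : Type*} [TopologicalSpace U] [ChartedSpace E U] [Group U]

/-- The differential at the identity of a map `φ : U → U` with `φ 1 = 1`, as a linear
endomorphism of the Lie algebra `𝔲 = T₁U`. -/
def diffOne (φ : U → U) : GroupLieAlgebra 𝓘(ℝ, E) U →ₗ[ℝ] GroupLieAlgebra 𝓘(ℝ, E) U :=
  (mfderiv 𝓘(ℝ, E) 𝓘(ℝ, E) φ (1 : U) : E →L[ℝ] E).toLinearMap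

/-- The adjoint representation `Ad k = d(u ↦ k u k⁻¹)₁`. -/
def Ad (k : U) : GroupLieAlgebra 𝓘(ℝ, E) U →ₗ[ℝ] GroupLieAlgebra 𝓘(ℝ, E) U :=
  diffOne (fun u : U => k * u * k⁻¹)

/-- The `-1` eigenspace `𝔮 = {X ∈ 𝔲 : dθ X = -X}` of the differential of an involution. -/
def oddPart (θ : U → U) : Submodule ℝ (GroupLieAlgebra 𝓘(ℝ, E) U) :=
  LinearMap.ker (diffOne (E := E) θ + LinearMap.id)

/-- A subspace of the Lie algebra on which the bracket vanishes. -/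
def IsAbelianSubspace (a : Submodule ℝ (GroupLieAlgebra 𝓘(ℝ, E) U)) : Prop :=
  ∀ x ∈ a, ∀ y ∈ a, ⁅x, y⁆ = 0

variable (E U) in
/-- A Riemannian symmetric space `X = U / K` presented by a Lie group `U`, an involutive
automorphism `θ`, a closed subgroup `K` with `(U^θ)₀ ⊆ K ⊆ U^θ`, and a `U`-invariant Riemannian
metric on `X`, that is, an `Ad(K)`-invariant inner product on `𝔮 ≅ T_o X`. An orthonormal basis
`frame` of `𝔮` is chosen; the Laplacian defined below does not depend on this choice. -/
structure SymmetricPair where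
  /-- the involution of `U` -/
  θ : U →* U
  contMDiff_θ : ContMDiff 𝓘(ℝ, E) 𝓘(ℝ, E) ∞ θ
  θ_θ : ∀ u, θ (θ u) = u
  /-- the isotropy group of the origin -/
  K : Subgroup U
  isClosed_K : IsClosed (K : Set U)
  K_fixed : ∀ k ∈ K, θ k = k
  component_subset_K : connectedComponentIn {u : U | θ u = u} 1 ⊆ (K : Set U)
  connected : ConnectedSpace (U ⧸ K)
  /-- the Riemannian metric at the origin; only its values on `𝔮` matter -/
  metric : LinearMap.BilinForm ℝ (GroupLieAlgebra 𝓘(ℝ, E) U)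
  metric_symm : ∀ x ∈ oddPart (E := E) θ, ∀ y ∈ oddPart (E := E) θ, metric x y = metric y x
  metric_pos : ∀ x ∈ oddPart (E := E) θ, x ≠ 0 → 0 < metric x x
  metric_Ad : ∀ k ∈ K, ∀ x ∈ oddPart (E := E) θ, ∀ y ∈ oddPart (E := E) θ,
    metric (Ad k x) (Ad k y) = metric x y
  /-- the dimension of `X` -/
  dim : ℕ
  /-- an orthonormal basis of `𝔮` -/
  frame : Fin dim → GroupLieAlgebra 𝓘(ℝ, E) U
  span_frame : Submodule.span ℝ (Set.range frame) = oddPart (E := E) θ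
  frame_orthonormal : ∀ i j, metric (frame i) (frame j) = if i = j then 1 else 0

namespace SymmetricPair

variable (S : SymmetricPair E U)

/-- The rank of `X` is one: there is a maximal abelian subspace of `𝔮` of dimension one. -/
def RankOne : Prop :=
  ∃ a : Submodule ℝ (GroupLieAlgebra 𝓘(ℝ, E) U),
    a ≤ oddPart (E := E) S.θ ∧ IsAbelianSubspace a ∧
    (∀ a' : Submodule ℝ (GroupLieAlgebra 𝓘(ℝ, E) U),
      a' ≤ oddPart (E := E) S.θ → IsAbelianSubspace a' → a ≤ a' → a' = a) ∧
    Module.finrank ℝ a = 1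

/-- The derivative of `f : U → ℂ` along the left-invariant vector field generated by `x`. -/
def invDeriv (x : GroupLieAlgebra 𝓘(ℝ, E) U) (f : U → ℂ) (u : U) : ℂ :=
  (mfderiv 𝓘(ℝ, E) 𝓘(ℝ, ℂ) f u : E →L[ℝ] ℂ) (mulInvariantVectorField (I := 𝓘(ℝ, E)) x u : E)

/-- The Laplace-Beltrami operator of `X = U / K`. Functions on `X` are identified with right
`K`-invariant functions on `U`; for those, `Δ f = ∑ Xᵢ Xᵢ f`, the sum being over an orthonormal
basis of `𝔮` acting by left-invariant vector fields (at `uK`, this is the trace of the second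
derivatives along the geodesics `t ↦ u exp(t Xᵢ) K`). -/
def laplacian (f : U → ℂ) (u : U) : ℂ :=
  ∑ i, invDeriv (S.frame i) (invDeriv (S.frame i) f) u

/-- Smooth functions on `X`, as smooth right `K`-invariant functions on `U`. -/
def IsSmoothOnX (f : U → ℂ) : Prop :=
  ContMDiff 𝓘(ℝ, E) 𝓘(ℝ, ℂ) ∞ f ∧ ∀ u, ∀ k ∈ S.K, f (u * k) = f u

/-- Smooth `K`-biinvariant functions. -/
def IsSmoothBiinvariant (f : U → ℂ) : Prop :=
  S.IsSmoothOnX f ∧ ∀ k ∈ S.K, ∀ u, f (k * u) = f u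

/-- `g` belongs to the eigenspace `H_r = ker(Δ + r²)`, that is, `√(-Δ) g = r g`. -/
def IsEigenfunction (r : ℝ≥0) (g : U → ℂ) : Prop :=
  S.IsSmoothOnX g ∧ ∀ u, S.laplacian g u = -((r : ℂ) ^ 2) * g u

variable [MeasurableSpace U] (μ : Measure U)

/-- `g` is the orthogonal projection of `f` onto the eigenspace `H_r` in `L²(X)`. -/
def IsSpectralComponent (r : ℝ≥0) (f g : U → ℂ) : Prop :=
  S.IsEigenfunction r g ∧
    ∀ h, S.IsEigenfunction r h → ∫ u, (f u - g u) * starRingEnd ℂ (h u) ∂μ = 0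

open Classical in
/-- The orthogonal projection `P_r f` of `f ∈ C^∞(X)` onto the (finite-dimensional) eigenspace
`H_r`; it is zero unless `r²` is an eigenvalue of `-Δ`. -/
def proj (r : ℝ≥0) (f : U → ℂ) : U → ℂ :=
  if h : ∃ g, S.IsSpectralComponent μ r f g then h.choose else 0

/-- The propagator `e^{-itψ(√-Δ)} f = ∑_r e^{-itψ(r)} P_r f` evaluated at a point of `X`; the sum
extends over the spectrum of `√-Δ` (all other terms vanish) and converges absolutely for smooth
`f`. -/
def propagate (ψ : ℝ≥0 → ℝ) (f : U → ℂ) (t : ℝ) (u : U) : ℂ :=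
  ∑' r : ℝ≥0, Complex.exp (-Complex.I * t * ψ r) * S.proj μ r f u

/-- The maximal function `sup_{0 ≤ t < 2π} |e^{-itψ(√-Δ)} f|`. -/
def maximalFunction (ψ : ℝ≥0 → ℝ) (f : U → ℂ) (u : U) : ℝ≥0∞ :=
  ⨆ t ∈ Set.Ico (0 : ℝ) (2 * Real.pi), ‖S.propagate μ ψ f t u‖ₑ

/-- The Sobolev norm `‖f‖_{H^α} = (∑_r (1 + r²)^α ‖P_r f‖²_{L²})^{1/2}`. -/
def sobolevNorm (α : ℝ) (f : U → ℂ) : ℝ≥0∞ :=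
  (∑' r : ℝ≥0, ENNReal.ofReal ((1 + (r : ℝ) ^ 2) ^ α) *
    eLpNorm (S.proj μ r f) 2 μ ^ (2 : ℕ)) ^ (1 / 2 : ℝ)

/-- The maximal estimate `‖sup_t |e^{-itψ(√-Δ)} f|‖_{L^p} ≤ C ‖f‖_{H^α}` on smooth `K`-biinvariant
functions, with a constant independent of `f`. -/
def MaximalEstimate (ψ : ℝ≥0 → ℝ) (p : ℝ≥0∞) (α : ℝ) : Prop :=
  ∃ C : ℝ≥0, 0 < C ∧ ∀ f : U → ℂ, S.IsSmoothBiinvariant f →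
    eLpNorm (S.maximalFunction μ ψ f) p μ ≤ C * S.sobolevNorm μ α f

/-- `(ψ₁, ψ₂)`-transferrability: for all `α₀ > 0` and `p ∈ [1, ∞]`, the maximal estimates for `ψ₁`
for all `α > α₀` imply those for `ψ₂`. -/
def TransferrableTo (ψ₁ ψ₂ : ℝ≥0 → ℝ) : Prop :=
  ∀ (α₀ : ℝ) (p : ℝ≥0∞), 0 < α₀ → 1 ≤ p →
    (∀ α, α₀ < α → S.MaximalEstimate μ ψ₁ p α) → ∀ α, α₀ < α → S.MaximalEstimate μ ψ₂ p α

/-- Transferrability in both directions. -/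
def Transferrable (ψ₁ ψ₂ : ℝ≥0 → ℝ) : Prop :=
  S.TransferrableTo μ ψ₁ ψ₂ ∧ S.TransferrableTo μ ψ₂ ψ₁

end SymmetricPair

/-- Comparable oscillation: `|ψ₁ - ψ₂|` is bounded on some half line `(R, ∞)`. -/
def ComparableOscillation (ψ₁ ψ₂ : ℝ≥0 → ℝ) : Prop :=
  ∃ R : ℝ≥0, 0 < R ∧ ∃ C : ℝ, 0 < C ∧ ∀ r, R < r → |ψ₁ r - ψ₂ r| ≤ C

end SymmSpace

end

noncomputable section

namespace SymmSpace

/-! ### Left-invariant derivatives as derivatives along curves. -/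

section Analysis

open Filter Topology SymmetricPair

variable {E : Type*} [NormedAddCommGroup E] [NormedSpace ℝ E]
  {U : Type*} [TopologicalSpace U] [ChartedSpace E U]
  {f g : U → ℂ}

/-! By compactness of `[0, R]`, `ψ₂ - ψ₁` is bounded by some `B` on all of `[0, ∞)`. Expand
`e^{-itψ₂} = ∑ₖ (-it)ᵏ/k! · (ψ₂ - ψ₁)ᵏ e^{-itψ₁}`. The multiplier `(ψ₂ - ψ₁)ᵏ` keeps biinvariance
and has norm at most `Bᵏ` on `H^α`, so the estimate for `ψ₁` and Minkowski's inequality give the one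
for `ψ₂` with the same `α` and constant `C ∑ₖ (2πB)ᵏ/k! = C e^{2πB}`
(`eLpNorm_maximalFunction_spectralSum_le`).

The expansion is carried out on finite spectral sums only: they are smooth, and their maximal
functions are measurable. The bound does not depend on the number of terms, so Fatou's lemma passes
it to general `f` (`maximalFunction_le_liminf`, `eLpNorm_le_of_le_liminf`).

What remains is that `P_r` acts on finite sums as expected (`proj_spectralSum`), by orthogonality of
eigenspaces, hence by Green's identity, and that `P_r` preserves biinvariance
(`isSmoothBiinvariant_proj`), by translation invariance and uniqueness of the projection. -/

theorem contMDiff_mul_complex (hf : ContMDiff 𝓘(ℝ, E) 𝓘(ℝ, ℂ) ∞ f)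
    (hg : ContMDiff 𝓘(ℝ, E) 𝓘(ℝ, ℂ) ∞ g) :
    ContMDiff 𝓘(ℝ, E) 𝓘(ℝ, ℂ) ∞ (fun v => f v * g v) :=
  (contDiff_mul (𝕜 := ℝ) (𝔸 := ℂ) (n := ∞)).contMDiff.comp (hf.prodMk_space hg)

theorem contMDiff_conj (hf : ContMDiff 𝓘(ℝ, E) 𝓘(ℝ, ℂ) ∞ f) :
    ContMDiff 𝓘(ℝ, E) 𝓘(ℝ, ℂ) ∞ (fun v => starRingEnd ℂ (f v)) :=
  (Complex.conjCLE.contDiff.contMDiff (n := ∞)).comp hf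

variable [Group U]

variable (U) in
/-- A curve through the identity with prescribed velocity: a straight line in the chart. -/
def curve (x : E) (t : ℝ) : U :=
  (chartAt E (1 : U)).symm (chartAt E (1 : U) 1 + t • x)

theorem curve_zero (x : E) : curve U x 0 = 1 := by
  simp [curve]

theorem eventually_mem_chart_target (x : E) :
    ∀ᶠ t : ℝ in 𝓝 0, chartAt E (1 : U) 1 + t • x ∈ (chartAt E (1 : U)).target := by
  have hc : Continuous fun t : ℝ => chartAt E (1 : U) 1 + t • x := by fun_prop
  refine hc.continuousAt.eventually ((chartAt E (1 : U)).open_target.mem_nhds ?_)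
  simp

variable [LieGroup 𝓘(ℝ, E) ∞ U]

theorem eventually_contMDiffAt_curve (x : E) :
    ∀ᶠ t : ℝ in 𝓝 0, ContMDiffAt 𝓘(ℝ, ℝ) 𝓘(ℝ, E) ∞ (curve U x) t := by
  filter_upwards [eventually_mem_chart_target (U := U) x] with t ht
  have h1 : ContMDiffAt 𝓘(ℝ, E) 𝓘(ℝ, E) ∞ (chartAt E (1 : U)).symm
      (chartAt E (1 : U) 1 + t • x) :=
    contMDiffOn_chart_symm.contMDiffAt ((chartAt E (1 : U)).open_target.mem_nhds ht)
  have h2 : ContMDiffAt 𝓘(ℝ, ℝ) 𝓘(ℝ, E) ∞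
      (fun t : ℝ => chartAt E (1 : U) 1 + t • x) t := by
    apply ContDiffAt.contMDiffAt
    fun_prop
  exact h1.comp t h2

theorem hasMFDerivAt_curve (x : E) :
    HasMFDerivAt 𝓘(ℝ, ℝ) 𝓘(ℝ, E) (curve U x) 0
      (ContinuousLinearMap.toSpanSingleton ℝ x : ℝ →L[ℝ] E) := by
  refine ⟨(eventually_contMDiffAt_curve x).self_of_nhds.continuousAt, ?_⟩
  have h : HasFDerivAt (fun t : ℝ => chartAt E (1 : U) 1 + t • x)
      (ContinuousLinearMap.toSpanSingleton ℝ x : ℝ →L[ℝ] E) 0 :=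
    ((ContinuousLinearMap.toSpanSingleton ℝ x).hasFDerivAt (x := (0 : ℝ))).const_add _
  refine HasFDerivAt.hasFDerivWithinAt (h.congr_of_eventuallyEq ?_)
  filter_upwards [eventually_mem_chart_target (U := U) x] with t ht
  simp only [writtenInExtChartAt, curve_zero, mfld_simps]
  exact (chartAt E (1 : U)).right_inv ht

theorem differentiableAt_translate_curve (hf : ContMDiff 𝓘(ℝ, E) 𝓘(ℝ, ℂ) ∞ f)
    {x : E} {t : ℝ} (ht : ContMDiffAt 𝓘(ℝ, ℝ) 𝓘(ℝ, E) ∞ (curve U x) t)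
    (u : U) : DifferentiableAt ℝ (fun s => f (u * curve U x s)) t := by
  have h : ContMDiffAt 𝓘(ℝ, ℝ) 𝓘(ℝ, ℂ) ∞ (fun s => f (u * curve U x s)) t :=
    hf.contMDiffAt.comp t (contMDiffAt_const.mul ht)
  exact (h.mdifferentiableAt (by simp)).differentiableAt

/-- Joint regularity in `(u, t)` serves twice: at `t = 0` it makes `invDeriv` smooth, and near `t =
0` it supplies the uniform bound for differentiating under the integral. -/
theorem contMDiffAt_deriv_translate_curve (hf : ContMDiff 𝓘(ℝ, E) 𝓘(ℝ, ℂ) ∞ f)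
    {x : E} {t : ℝ} (ht : ContMDiffAt 𝓘(ℝ, ℝ) 𝓘(ℝ, E) ∞ (curve U x) t)
    (u : U) :
    ContMDiffAt (𝓘(ℝ, E).prod 𝓘(ℝ, ℝ)) 𝓘(ℝ, ℂ) ∞
      (fun q : U × ℝ => deriv (fun s => f (q.1 * curve U x s)) q.2) (u, t) := by
  have h1 : ContMDiffAt ((𝓘(ℝ, E).prod 𝓘(ℝ, ℝ)).prod 𝓘(ℝ, ℝ)) 𝓘(ℝ, ℂ) ∞
      (Function.uncurry fun (q : U × ℝ) (s : ℝ) => f (q.1 * curve U x s)) ((u, t), t) := by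
    exact hf.contMDiffAt.comp ((u, t), t)
      ((contMDiffAt_fst.comp ((u, t), t) contMDiffAt_fst).mul
        (ContMDiffAt.comp (I' := 𝓘(ℝ, ℝ)) (g := curve U x) (f := Prod.snd) ((u, t), t) ht
          contMDiffAt_snd))
  have h2 := ContMDiffAt.mfderiv (m := ∞) (x₀ := ((u, t) : U × ℝ)) _ (fun q : U × ℝ => q.2) h1
    contMDiffAt_snd (by simp)
  have h2' : ContMDiffAt (𝓘(ℝ, E).prod 𝓘(ℝ, ℝ)) 𝓘(ℝ, ℝ →L[ℝ] ℂ) ∞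
      (fun q : U × ℝ => fderiv ℝ (fun s => f (q.1 * curve U x s)) q.2) (u, t) := by
    have e := inTangentCoordinates_model_space (I := 𝓘(ℝ, ℝ)) (I' := 𝓘(ℝ, ℂ))
      (fun q : U × ℝ => q.2) (fun q : U × ℝ => f (q.1 * curve U x q.2))
      (fun q : U × ℝ => fderiv ℝ (fun s => f (q.1 * curve U x s)) q.2) (u, t)
    rw [← e]
    simp only [mfderiv_eq_fderiv] at h2
    exact h2
  have h3 := h2'.clm_apply (contMDiffAt_const (c := (1 : ℝ)))
  refine h3.congr_of_eventuallyEq (Eventually.of_forall fun q => ?_)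
  exact fderiv_apply_one_eq_deriv.symm

/-- The derivative along a left-invariant vector field, as the derivative along right translates
of a curve through the identity. -/
theorem hasDerivAt_translate_curve (hf : ContMDiff 𝓘(ℝ, E) 𝓘(ℝ, ℂ) ∞ f)
    (x : E) (u : U) :
    HasDerivAt (fun s => f (u * curve U x s)) (invDeriv (E := E) x f u) 0 := by
  have h1 : HasMFDerivAt 𝓘(ℝ, E) 𝓘(ℝ, E) (u * ·) 1
      (mfderiv 𝓘(ℝ, E) 𝓘(ℝ, E) (u * ·) (1 : U)) :=
    ((contMDiff_mul_left (I := 𝓘(ℝ, E)) (n := ∞)).contMDiffAt.mdifferentiableAt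
      (by simp)).hasMFDerivAt
  have h2 : HasMFDerivAt 𝓘(ℝ, E) 𝓘(ℝ, ℂ) f u (mfderiv 𝓘(ℝ, E) 𝓘(ℝ, ℂ) f u) :=
    (hf.contMDiffAt.mdifferentiableAt (by simp)).hasMFDerivAt
  unfold invDeriv mulInvariantVectorField
  -- `curve U x 0` equals `1` only propositionally, so the differentials are treated as plain maps
  -- on `E` and then moved to the base points that the chain rule produces.
  generalize mfderiv 𝓘(ℝ, E) 𝓘(ℝ, E) (u * ·) (1 : U) = A at h1 ⊢
  generalize mfderiv 𝓘(ℝ, E) 𝓘(ℝ, ℂ) f u = B at h2 ⊢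
  change E →L[ℝ] E at A
  change E →L[ℝ] ℂ at B
  have h1' : ∀ v : U, v = 1 → HasMFDerivAt 𝓘(ℝ, E) 𝓘(ℝ, E) (u * ·) v A := by
    rintro _ rfl; exact h1
  have h2' : ∀ v : U, v = u → HasMFDerivAt 𝓘(ℝ, E) 𝓘(ℝ, ℂ) f v B := by
    rintro _ rfl; exact h2
  have h3 : HasMFDerivAt 𝓘(ℝ, ℝ) 𝓘(ℝ, ℂ) (fun s => f (u * curve U x s)) 0
      (B.comp (A.comp (ContinuousLinearMap.toSpanSingleton ℝ x)) : ℝ →L[ℝ] ℂ) :=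
    (h2' _ (by simp [curve_zero])).comp (0 : ℝ)
      ((h1' _ (curve_zero x)).comp (0 : ℝ) (hasMFDerivAt_curve x))
  have h4 : HasFDerivAt (fun s => f (u * curve U x s))
      (B.comp (A.comp (ContinuousLinearMap.toSpanSingleton ℝ x)) : ℝ →L[ℝ] ℂ) (0 : ℝ) :=
    hasMFDerivAt_iff_hasFDerivAt.1 h3
  exact h4.hasDerivAt.congr_deriv (congrArg (fun y => B (A y)) (one_smul ℝ x))

theorem invDeriv_eq_deriv (hf : ContMDiff 𝓘(ℝ, E) 𝓘(ℝ, ℂ) ∞ f)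
    (x : E) (u : U) :
    invDeriv (E := E) x f u = deriv (fun s => f (u * curve U x s)) 0 :=
  (hasDerivAt_translate_curve hf x u).deriv.symm

theorem contMDiff_invDeriv (hf : ContMDiff 𝓘(ℝ, E) 𝓘(ℝ, ℂ) ∞ f)
    (x : E) : ContMDiff 𝓘(ℝ, E) 𝓘(ℝ, ℂ) ∞ (invDeriv (E := E) x f) := by
  intro u
  have h := contMDiffAt_deriv_translate_curve hf
    (eventually_contMDiffAt_curve x).self_of_nhds u
  have h' := h.comp u (contMDiffAt_id.prodMk (contMDiffAt_const (c := (0 : ℝ))))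
  refine h'.congr_of_eventuallyEq (Eventually.of_forall fun v => ?_)
  exact invDeriv_eq_deriv hf x v

theorem invDeriv_translate (hf : ContMDiff 𝓘(ℝ, E) 𝓘(ℝ, ℂ) ∞ f)
    (x : E) (k u : U) :
    invDeriv (E := E) x (fun v => f (k * v)) u = invDeriv (E := E) x f (k * u) := by
  have h : ContMDiff 𝓘(ℝ, E) 𝓘(ℝ, ℂ) ∞ (fun v => f (k * v)) := hf.comp contMDiff_mul_left
  simp [invDeriv_eq_deriv h, invDeriv_eq_deriv hf, mul_assoc]

theorem invDeriv_add (hf : ContMDiff 𝓘(ℝ, E) 𝓘(ℝ, ℂ) ∞ f) (hg : ContMDiff 𝓘(ℝ, E) 𝓘(ℝ, ℂ) ∞ g)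
    (x : E) (u : U) :
    invDeriv (E := E) x (fun v => f v + g v) u = invDeriv (E := E) x f u + invDeriv (E := E) x g u := by
  have hfg : ContMDiff 𝓘(ℝ, E) 𝓘(ℝ, ℂ) ∞ (fun v => f v + g v) := hf.add hg
  rw [invDeriv_eq_deriv hfg]
  exact ((hasDerivAt_translate_curve hf x u).add (hasDerivAt_translate_curve hg x u)).deriv

theorem invDeriv_mul (hf : ContMDiff 𝓘(ℝ, E) 𝓘(ℝ, ℂ) ∞ f) (hg : ContMDiff 𝓘(ℝ, E) 𝓘(ℝ, ℂ) ∞ g)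
    (x : E) (u : U) :
    invDeriv (E := E) x (fun v => f v * g v) u = invDeriv (E := E) x f u * g u + f u * invDeriv (E := E) x g u := by
  rw [invDeriv_eq_deriv (contMDiff_mul_complex hf hg)]
  have h := (hasDerivAt_translate_curve hf x u).mul (hasDerivAt_translate_curve hg x u)
  simp only [curve_zero, mul_one] at h
  exact h.deriv

theorem invDeriv_const_mul (hf : ContMDiff 𝓘(ℝ, E) 𝓘(ℝ, ℂ) ∞ f) (c : ℂ)
    (x : E) (u : U) :
    invDeriv (E := E) x (fun v => c * f v) u = c * invDeriv (E := E) x f u := by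
  rw [invDeriv_eq_deriv (contMDiff_mul_complex contMDiff_const hf)]
  exact ((hasDerivAt_translate_curve hf x u).const_mul c).deriv

theorem invDeriv_conj (hf : ContMDiff 𝓘(ℝ, E) 𝓘(ℝ, ℂ) ∞ f)
    (x : E) (u : U) :
    invDeriv (E := E) x (fun v => starRingEnd ℂ (f v)) u = starRingEnd ℂ (invDeriv (E := E) x f u) := by
  rw [invDeriv_eq_deriv (contMDiff_conj hf)]
  exact ((Complex.conjCLE.hasFDerivAt (x := f (u * curve U x 0))).comp_hasDerivAt (0 : ℝ)
    (hasDerivAt_translate_curve hf x u)).deriv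

end Analysis

/-! ### Haar integration by parts. -/

section Integration

open Filter Topology SymmetricPair

theorem integrable_of_continuous {U : Type*} [TopologicalSpace U] [CompactSpace U]
    [MeasurableSpace U] [BorelSpace U] (μ : Measure U) [IsFiniteMeasure μ] {f : U → ℂ}
    (hf : Continuous f) : Integrable f μ :=
  hf.integrable_of_hasCompactSupport (HasCompactSupport.of_compactSpace f)

/-- A right translate of `μ` is again a Haar probability measure, and such a measure is unique. -/
theorem isMulRightInvariant_of_compact {U : Type*} [TopologicalSpace U] [Group U]
    [IsTopologicalGroup U] [CompactSpace U] [T2Space U] [MeasurableSpace U] [BorelSpace U]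
    (μ : Measure U) [μ.IsHaarMeasure] [IsProbabilityMeasure μ] : μ.IsMulRightInvariant := by
  refine ⟨fun g => ?_⟩
  have : IsProbabilityMeasure (μ.map (· * g)) :=
    Measure.isProbabilityMeasure_map (continuous_mul_const g).aemeasurable
  exact Measure.isHaarMeasure_eq_of_isProbabilityMeasure _ _

variable {E : Type*} [NormedAddCommGroup E] [NormedSpace ℝ E]
  {U : Type*} [TopologicalSpace U] [ChartedSpace E U] [Group U] [LieGroup 𝓘(ℝ, E) ∞ U]
  [CompactSpace U] [T2Space U] [MeasurableSpace U] [BorelSpace U]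
  (μ : Measure U) [μ.IsHaarMeasure] [IsProbabilityMeasure μ] {f g : U → ℂ}

/-- By right invariance `∫ f(u c(t)) du` is constant in `t`; differentiate at `t = 0` under the
integral, with a dominating constant from compactness of `U` times a small interval. -/
theorem integral_invDeriv_eq_zero (hf : ContMDiff 𝓘(ℝ, E) 𝓘(ℝ, ℂ) ∞ f)
    (x : E) : ∫ u, invDeriv (E := E) x f u ∂μ = 0 := by
  have : IsTopologicalGroup U := topologicalGroup_of_lieGroup 𝓘(ℝ, E) ∞
  have := isMulRightInvariant_of_compact μ
  obtain ⟨ε, hε, hball⟩ := Metric.nhds_basis_closedBall.eventually_iff.1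
    (eventually_contMDiffAt_curve (U := U) x)
  have hcont : ContinuousOn (fun q : U × ℝ => deriv (fun s => f (q.1 * curve U x s)) q.2)
      (Set.univ ×ˢ Metric.closedBall 0 ε) := fun q hq =>
    (contMDiffAt_deriv_translate_curve hf (hball hq.2) q.1).continuousAt.continuousWithinAt
  obtain ⟨B, hB⟩ := (isCompact_univ.prod (isCompact_closedBall (0 : ℝ) ε)).exists_bound_of_continuousOn
    hcont
  have hc : ∀ t, Continuous fun u => f (u * curve U x t) := fun t =>
    hf.continuous.comp (continuous_mul_const _)
  have key := (hasDerivAt_integral_of_dominated_loc_of_deriv_le (μ := μ) (𝕜 := ℝ)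
    (F := fun t u => f (u * curve U x t))
    (F' := fun t u => deriv (fun s => f (u * curve U x s)) t) (bound := fun _ => B)
    (Metric.closedBall_mem_nhds (0 : ℝ) hε)
    (Eventually.of_forall fun t => (hc t).aestronglyMeasurable)
    (integrable_of_continuous μ (hc 0))
    (by
      have := (contMDiff_invDeriv hf x).continuous
      simp only [← invDeriv_eq_deriv hf x]
      exact this.aestronglyMeasurable)
    (Eventually.of_forall fun u t ht => hB (u, t) ⟨trivial, ht⟩)
    (integrable_const _)
    (Eventually.of_forall fun u t ht =>
      (differentiableAt_translate_curve hf (hball ht) u).hasDerivAt)).2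
  simp only [integral_mul_right_eq_self, ← invDeriv_eq_deriv hf x] at key
  exact key.unique (hasDerivAt_const _ _)

theorem integral_invDeriv_mul (hf : ContMDiff 𝓘(ℝ, E) 𝓘(ℝ, ℂ) ∞ f)
    (hg : ContMDiff 𝓘(ℝ, E) 𝓘(ℝ, ℂ) ∞ g) (x : E) :
    ∫ u, invDeriv (E := E) x f u * g u ∂μ = - ∫ u, f u * invDeriv (E := E) x g u ∂μ := by
  have h := integral_invDeriv_eq_zero μ (contMDiff_mul_complex hf hg) x
  have h1 := (contMDiff_invDeriv hf x).continuous
  have h2 := (contMDiff_invDeriv hg x).continuous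
  have h3 := hf.continuous
  have h4 := hg.continuous
  have h5 : ∀ u, invDeriv (E := E) x (fun v => f v * g v) u = invDeriv (E := E) x f u * g u + f u * invDeriv (E := E) x g u :=
    invDeriv_mul hf hg x
  simp only [h5] at h
  rw [integral_add (integrable_of_continuous μ (by fun_prop))
    (integrable_of_continuous μ (by fun_prop))] at h
  exact eq_neg_of_add_eq_zero_left h

end Integration

namespace SymmetricPair

/-! ### Algebra of the Laplacian and of its eigenspaces. -/

section Laplacian

set_option linter.unusedSectionVars false

variable {E : Type*} [NormedAddCommGroup E] [NormedSpace ℝ E]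
  {U : Type*} [TopologicalSpace U] [ChartedSpace E U] [Group U] [LieGroup 𝓘(ℝ, E) ∞ U]
  {S : SymmetricPair E U} {f g : U → ℂ} {r : ℝ≥0}

theorem laplacian_add (hf : ContMDiff 𝓘(ℝ, E) 𝓘(ℝ, ℂ) ∞ f)
    (hg : ContMDiff 𝓘(ℝ, E) 𝓘(ℝ, ℂ) ∞ g) (u : U) :
    S.laplacian (fun v => f v + g v) u = S.laplacian f u + S.laplacian g u := by
  simp only [laplacian, ← Finset.sum_add_distrib]
  refine Finset.sum_congr rfl fun i _ => ?_
  rw [funext (invDeriv_add hf hg (S.frame i))]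
  exact invDeriv_add (contMDiff_invDeriv hf _) (contMDiff_invDeriv hg _) _ u

theorem laplacian_const_mul (hf : ContMDiff 𝓘(ℝ, E) 𝓘(ℝ, ℂ) ∞ f) (c : ℂ) (u : U) :
    S.laplacian (fun v => c * f v) u = c * S.laplacian f u := by
  simp only [laplacian, Finset.mul_sum]
  refine Finset.sum_congr rfl fun i _ => ?_
  rw [funext (invDeriv_const_mul hf c (S.frame i))]
  exact invDeriv_const_mul (contMDiff_invDeriv hf _) c _ u

theorem laplacian_conj (hf : ContMDiff 𝓘(ℝ, E) 𝓘(ℝ, ℂ) ∞ f) (u : U) :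
    S.laplacian (fun v => starRingEnd ℂ (f v)) u = starRingEnd ℂ (S.laplacian f u) := by
  simp only [laplacian, map_sum]
  refine Finset.sum_congr rfl fun i _ => ?_
  rw [funext (invDeriv_conj hf (S.frame i))]
  exact invDeriv_conj (contMDiff_invDeriv hf _) _ u

theorem laplacian_translate (hf : ContMDiff 𝓘(ℝ, E) 𝓘(ℝ, ℂ) ∞ f) (k u : U) :
    S.laplacian (fun v => f (k * v)) u = S.laplacian f (k * u) := by
  refine Finset.sum_congr rfl fun i _ => ?_
  rw [funext (invDeriv_translate hf (S.frame i) k)]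
  exact invDeriv_translate (contMDiff_invDeriv hf _) _ k u

theorem IsEigenfunction.contMDiff (h : S.IsEigenfunction r g) :
    ContMDiff 𝓘(ℝ, E) 𝓘(ℝ, ℂ) ∞ g := h.1.1

theorem IsEigenfunction.continuous (h : S.IsEigenfunction r g) : Continuous g :=
  h.contMDiff.continuous

theorem IsEigenfunction.add (hf : S.IsEigenfunction r f) (hg : S.IsEigenfunction r g) :
    S.IsEigenfunction r fun u => f u + g u := by
  refine ⟨⟨hf.1.1.add hg.1.1, fun u k hk => ?_⟩, fun u => ?_⟩
  · simp only [hf.1.2 u k hk, hg.1.2 u k hk]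
  · rw [laplacian_add hf.1.1 hg.1.1, hf.2, hg.2]
    ring

theorem IsEigenfunction.const_mul (hf : S.IsEigenfunction r f) (c : ℂ) :
    S.IsEigenfunction r fun u => c * f u := by
  refine ⟨⟨contMDiff_mul_complex contMDiff_const hf.1.1, fun u k hk => ?_⟩, fun u => ?_⟩
  · simp only [hf.1.2 u k hk]
  · rw [laplacian_const_mul hf.1.1, hf.2]
    ring

theorem IsEigenfunction.sub (hf : S.IsEigenfunction r f) (hg : S.IsEigenfunction r g) :
    S.IsEigenfunction r fun u => f u - g u := by
  simpa [sub_eq_add_neg] using hf.add (hg.const_mul (-1))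

theorem isEigenfunction_zero : S.IsEigenfunction r 0 := by
  have h : ContMDiff 𝓘(ℝ, E) 𝓘(ℝ, ℂ) ∞ (fun _ : U => (0 : ℂ)) := contMDiff_const
  refine ⟨⟨h, fun _ _ _ => rfl⟩, fun u => ?_⟩
  simpa [Pi.zero_def] using laplacian_const_mul (S := S) h 0 u

theorem IsEigenfunction.translate (hf : S.IsEigenfunction r f) (k : U) :
    S.IsEigenfunction r fun u => f (k * u) := by
  refine ⟨⟨hf.1.1.comp contMDiff_mul_left, fun u k' hk => ?_⟩, fun u => ?_⟩
  · simp only [← mul_assoc, hf.1.2 _ k' hk]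
  · rw [laplacian_translate hf.1.1, hf.2]

end Laplacian

/-! ### Orthogonality, spectral projections and finite spectral sums. -/

section Spectral

set_option linter.unusedSectionVars false

variable {E : Type*} [NormedAddCommGroup E] [NormedSpace ℝ E]
  {U : Type*} [TopologicalSpace U] [ChartedSpace E U] [Group U] [LieGroup 𝓘(ℝ, E) ∞ U]
  [CompactSpace U] [T2Space U] [MeasurableSpace U] [BorelSpace U]
  {μ : Measure U} [μ.IsHaarMeasure] [IsProbabilityMeasure μ]
  {S : SymmetricPair E U} {f g : U → ℂ} {r s : ℝ≥0}

/-- Green's identity: the Laplacian is symmetric. -/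
theorem integral_laplacian_mul (hf : ContMDiff 𝓘(ℝ, E) 𝓘(ℝ, ℂ) ∞ f)
    (hg : ContMDiff 𝓘(ℝ, E) 𝓘(ℝ, ℂ) ∞ g) :
    ∫ u, S.laplacian f u * g u ∂μ = ∫ u, f u * S.laplacian g u ∂μ := by
  have h1 := fun i => (contMDiff_invDeriv (contMDiff_invDeriv hf (S.frame i)) (S.frame i)).continuous
  have h2 := fun i => (contMDiff_invDeriv (contMDiff_invDeriv hg (S.frame i)) (S.frame i)).continuous
  have h3 := hf.continuous
  have h4 := hg.continuous
  simp only [laplacian, Finset.mul_sum, Finset.sum_mul]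
  rw [integral_finsetSum _ fun i _ => integrable_of_continuous μ (by fun_prop),
    integral_finsetSum _ fun i _ => integrable_of_continuous μ (by fun_prop)]
  refine Finset.sum_congr rfl fun i _ => ?_
  exact (integral_invDeriv_mul μ (contMDiff_invDeriv hf _) hg _).trans
    (neg_eq_iff_eq_neg.2 (integral_invDeriv_mul μ hf (contMDiff_invDeriv hg _) _))

/-- Eigenfunctions for different eigenvalues are orthogonal. -/
theorem IsEigenfunction.integral_mul_conj_eq_zero (hf : S.IsEigenfunction r f)
    (hg : S.IsEigenfunction s g) (hrs : r ≠ s) : ∫ u, f u * starRingEnd ℂ (g u) ∂μ = 0 := by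
  have h := integral_laplacian_mul (S := S) (μ := μ) hf.1.1 (contMDiff_conj hg.1.1)
  simp only [laplacian_conj hg.1.1, hf.2, hg.2] at h
  have e1 : ∀ u, -(r : ℂ) ^ 2 * f u * starRingEnd ℂ (g u)
      = -(r : ℂ) ^ 2 * (f u * starRingEnd ℂ (g u)) := fun u => by ring
  have e2 : ∀ u, f u * starRingEnd ℂ (-(s : ℂ) ^ 2 * g u)
      = -(s : ℂ) ^ 2 * (f u * starRingEnd ℂ (g u)) := fun u => by
    have : starRingEnd ℂ ((s : ℝ≥0) : ℂ) = (s : ℂ) := Complex.conj_ofReal _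
    simp only [map_mul, map_neg, map_pow, this]
    ring
  simp only [e1, e2, integral_const_mul] at h
  have h0 : (-(r : ℂ) ^ 2 + (s : ℂ) ^ 2) * ∫ u, f u * starRingEnd ℂ (g u) ∂μ = 0 := by
    linear_combination h
  refine (mul_eq_zero.1 h0).resolve_left fun h2 => hrs ?_
  have h3 : (r : ℝ) ^ 2 = (s : ℝ) ^ 2 := by
    have : (((r : ℝ) ^ 2 : ℝ) : ℂ) = (((s : ℝ) ^ 2 : ℝ) : ℂ) := by
      push_cast
      linear_combination -h2
    exact_mod_cast this
  exact NNReal.coe_injective ((sq_eq_sq₀ r.coe_nonneg s.coe_nonneg).1 h3)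

theorem eq_zero_of_integral_mul_conj_self {U : Type*} [TopologicalSpace U] [CompactSpace U]
    [MeasurableSpace U] [BorelSpace U] {μ : Measure U} [IsFiniteMeasure μ] [μ.IsOpenPosMeasure]
    {f : U → ℂ} (hf : Continuous f) (h : ∫ u, f u * starRingEnd ℂ (f u) ∂μ = 0) : f = 0 := by
  have h1 : ∫ u, Complex.normSq (f u) ∂μ = 0 := by
    simp only [Complex.mul_conj] at h
    rw [integral_complex_ofReal] at h
    exact_mod_cast h
  have hc : Continuous fun u => Complex.normSq (f u) := Complex.continuous_normSq.comp hf
  have h2 : (fun u => Complex.normSq (f u)) = 0 := by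
    by_contra hne
    obtain ⟨x, hx⟩ := Function.ne_iff.1 hne
    exact (hc.integral_pos_of_hasCompactSupport_nonneg_nonzero (μ := μ)
      (HasCompactSupport.of_compactSpace _) (fun u => Complex.normSq_nonneg _) hx).ne' h1
  exact funext fun u => Complex.normSq_eq_zero.1 (congrFun h2 u)

/-- The difference lies in the eigenspace and is orthogonal to it, hence to itself; being
continuous, it vanishes everywhere. -/
theorem IsSpectralComponent.unique {f g₁ g₂ : U → ℂ} (hf : Continuous f)
    (h₁ : S.IsSpectralComponent μ r f g₁) (h₂ : S.IsSpectralComponent μ r f g₂) : g₁ = g₂ := by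
  have hd := h₁.1.sub h₂.1
  have hc1 := h₁.1.continuous
  have hc2 := h₂.1.continuous
  have hconj := Complex.continuous_conj
  have h0 := eq_zero_of_integral_mul_conj_self (μ := μ) hd.continuous ?_
  · exact funext fun u => sub_eq_zero.1 (congrFun h0 u)
  · have e : ∀ u, (g₁ u - g₂ u) * starRingEnd ℂ (g₁ u - g₂ u)
        = (f u - g₂ u) * starRingEnd ℂ (g₁ u - g₂ u)
          - (f u - g₁ u) * starRingEnd ℂ (g₁ u - g₂ u) := fun u => by ring
    simp only [e]
    rw [integral_sub (integrable_of_continuous μ (by fun_prop))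
      (integrable_of_continuous μ (by fun_prop)), h₁.2 _ hd, h₂.2 _ hd, sub_zero]

theorem IsSpectralComponent.proj_eq (hf : Continuous f) (h : S.IsSpectralComponent μ r f g) :
    S.proj μ r f = g := by
  have hex : ∃ g, S.IsSpectralComponent μ r f g := ⟨g, h⟩
  rw [proj, dif_pos hex]
  exact hex.choose_spec.unique hf h

variable (μ S) in
-- The default value `0` of `proj` is an eigenfunction too, so existence of the orthogonal
-- projection need not be proved.
theorem isEigenfunction_proj (r : ℝ≥0) (f : U → ℂ) : S.IsEigenfunction r (S.proj μ r f) := by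
  unfold proj
  split_ifs with h
  · exact h.choose_spec.1
  · exact isEigenfunction_zero

/-- Invariance of `μ` moves the translation by `k` onto the test eigenfunction. -/
theorem IsSpectralComponent.translate (h : S.IsSpectralComponent μ r f g) (k : U) :
    S.IsSpectralComponent μ r (fun u => f (k * u)) (fun u => g (k * u)) := by
  have : IsTopologicalGroup U := topologicalGroup_of_lieGroup 𝓘(ℝ, E) ∞
  refine ⟨h.1.translate k, fun φ hφ => ?_⟩
  have e := integral_mul_left_eq_self (μ := μ)
    (fun u => (f u - g u) * starRingEnd ℂ (φ (k⁻¹ * u))) k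
  simp only [inv_mul_cancel_left] at e
  rw [e]
  exact h.2 _ (hφ.translate k⁻¹)

/-- For `k ∈ K` the translate of a component of `f` is a component of the translate of `f`, which is
`f` itself; uniqueness concludes. -/
theorem isSmoothBiinvariant_proj (hf : S.IsSmoothBiinvariant f) (r : ℝ≥0) :
    S.IsSmoothBiinvariant (S.proj μ r f) := by
  refine ⟨(isEigenfunction_proj μ S r f).1, fun k hk u => ?_⟩
  by_cases h : ∃ g, S.IsSpectralComponent μ r f g
  · obtain ⟨g, hg⟩ := h
    have hk' : (fun u => f (k * u)) = f := funext fun u => hf.2 k hk u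
    have h2 := hg.translate k
    rw [hk'] at h2
    rw [hg.proj_eq hf.1.1.continuous]
    exact congrFun (h2.unique hf.1.1.continuous hg) u
  · simp [proj, h]

variable (S μ) in
/-- The finite spectral sum `∑ c(r) P_r f` over a finite set of frequencies. -/
def spectralSum (F : Finset ℝ≥0) (c : ℝ≥0 → ℂ) (f : U → ℂ) (u : U) : ℂ :=
  ∑ r ∈ F, c r * S.proj μ r f u

theorem isSmoothBiinvariant_spectralSum (hf : S.IsSmoothBiinvariant f) (F : Finset ℝ≥0)
    (c : ℝ≥0 → ℂ) : S.IsSmoothBiinvariant (S.spectralSum μ F c f) := by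
  have hp := fun r => isSmoothBiinvariant_proj (μ := μ) hf r
  refine ⟨⟨contMDiff_finsetSum fun r _ => contMDiff_mul_complex contMDiff_const (hp r).1.1,
    fun u k hk => ?_⟩, fun k hk u => ?_⟩
  · exact Finset.sum_congr rfl fun r _ => by rw [(hp r).1.2 u k hk]
  · exact Finset.sum_congr rfl fun r _ => by rw [(hp r).2 k hk u]

/-- The spectral components of a finite spectral sum. -/
theorem proj_spectralSum (F : Finset ℝ≥0) (c : ℝ≥0 → ℂ) (f : U → ℂ) (s : ℝ≥0) :
    S.proj μ s (S.spectralSum μ F c f) =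
      fun u => if s ∈ F then c s * S.proj μ s f u else 0 := by
  have hp := fun r => isEigenfunction_proj μ S r f
  have hpc := fun r => (hp r).continuous
  have hterm := fun r => ((hp r).const_mul (c r))
  have hcont : Continuous (S.spectralSum μ F c f) := by
    unfold spectralSum
    fun_prop
  refine IsSpectralComponent.proj_eq hcont ⟨?_, fun h hh => ?_⟩
  · by_cases hs : s ∈ F
    · simpa only [hs, if_true] using hterm s
    · simp only [hs, if_false]
      exact isEigenfunction_zero
  · have e : ∀ u, S.spectralSum μ F c f u - (if s ∈ F then c s * S.proj μ s f u else 0)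
        = ∑ r ∈ F.erase s, c r * S.proj μ r f u := fun u => by
      by_cases hs : s ∈ F
      · rw [spectralSum, ← Finset.add_sum_erase F _ hs, if_pos hs, add_sub_cancel_left]
      · rw [spectralSum, if_neg hs, Finset.erase_eq_of_notMem hs, sub_zero]
    simp only [e, Finset.sum_mul]
    have hhc := hh.continuous
    have hconj := Complex.continuous_conj
    rw [integral_finsetSum _ fun r _ => integrable_of_continuous μ (by fun_prop)]
    exact Finset.sum_eq_zero fun r hr =>
      (hterm r).integral_mul_conj_eq_zero hh (Finset.ne_of_mem_erase hr)

theorem propagate_spectralSum (ψ : ℝ≥0 → ℝ) (F : Finset ℝ≥0) (c : ℝ≥0 → ℂ) (f : U → ℂ)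
    (t : ℝ) (u : U) :
    S.propagate μ ψ (S.spectralSum μ F c f) t u =
      ∑ r ∈ F, Complex.exp (-Complex.I * t * ψ r) * (c r * S.proj μ r f u) := by
  simp only [propagate, proj_spectralSum]
  rw [tsum_eq_sum (s := F) fun r hr => by simp [hr]]
  exact Finset.sum_congr rfl fun r hr => by rw [if_pos hr]

/-- The supremum over `t` is uncountable, but each term is continuous in `u`, so the supremum is
lower semicontinuous. -/
theorem measurable_maximalFunction_spectralSum (ψ : ℝ≥0 → ℝ) (F : Finset ℝ≥0) (c : ℝ≥0 → ℂ)
    (f : U → ℂ) : Measurable (S.maximalFunction μ ψ (S.spectralSum μ F c f)) := by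
  refine LowerSemicontinuous.measurable ?_
  unfold maximalFunction
  simp only [propagate_spectralSum]
  refine lowerSemicontinuous_biSup fun t _ => Continuous.lowerSemicontinuous ?_
  have hpc := fun r => (isEigenfunction_proj μ S r f).continuous
  fun_prop

theorem sobolevNorm_spectralSum_le (F : Finset ℝ≥0) (c : ℝ≥0 → ℂ) (B : ℝ≥0)
    (hB : ∀ r, ‖c r‖ₑ ≤ B) (α : ℝ) (f : U → ℂ) :
    S.sobolevNorm μ α (S.spectralSum μ F c f) ≤ B * S.sobolevNorm μ α f := by
  have hle : ∀ r, eLpNorm (S.proj μ r (S.spectralSum μ F c f)) 2 μ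
      ≤ B * eLpNorm (S.proj μ r f) 2 μ := fun r => by
    rw [proj_spectralSum]
    by_cases hr : r ∈ F
    · simp only [hr, if_true]
      calc eLpNorm (fun u => c r * S.proj μ r f u) 2 μ
          = ‖c r‖ₑ * eLpNorm (S.proj μ r f) 2 μ := eLpNorm_const_smul (c r) (S.proj μ r f) 2 μ
        _ ≤ _ := by gcongr; exact hB r
    · simp [hr]
  -- Writes `B` as a square root so that it can be absorbed into the sum under the root.
  have hsq : (B : ℝ≥0∞) = ((B : ℝ≥0∞) ^ (2 : ℕ)) ^ (1 / 2 : ℝ) := by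
    rw [← ENNReal.rpow_natCast, ← ENNReal.rpow_mul]
    norm_num
  unfold sobolevNorm
  rw [hsq]
  rw [← ENNReal.mul_rpow_of_nonneg _ _ (by norm_num), ← ENNReal.tsum_mul_left]
  refine ENNReal.rpow_le_rpow (ENNReal.tsum_le_tsum fun r => ?_) (by norm_num)
  calc _ ≤ ENNReal.ofReal ((1 + (r : ℝ) ^ 2) ^ α) * (B * eLpNorm (S.proj μ r f) 2 μ) ^ 2 := by
        gcongr
        exact hle r
    _ = _ := by ring

/-- Fatou's lemma needs a sequence of truncations, hence countably many frequencies. A convergent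
series in `[0, ∞]` has countable support, and a continuous projection with zero `L²` norm is
identically zero. -/
theorem countable_support_proj {α : ℝ} (h : S.sobolevNorm μ α f ≠ ⊤) :
    {r : ℝ≥0 | S.proj μ r f ≠ 0}.Countable := by
  have h1 : (∑' r : ℝ≥0, ENNReal.ofReal ((1 + (r : ℝ) ^ 2) ^ α) *
      eLpNorm (S.proj μ r f) 2 μ ^ (2 : ℕ)) ≠ ⊤ := fun h2 => h (by
    rw [sobolevNorm, h2]; exact ENNReal.top_rpow_of_pos (by norm_num))
  refine (Summable.countable_support_ennreal h1).mono fun r hr => ?_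
  simp only [Set.mem_ofPred_eq, Function.mem_support] at hr ⊢
  refine fun hr0 => hr ?_
  have hc := (isEigenfunction_proj μ S r f).continuous
  have hpos : 0 < (1 + (r : ℝ) ^ 2) ^ α := Real.rpow_pos_of_pos (by positivity) _
  have h3 : eLpNorm (S.proj μ r f) 2 μ = 0 := by
    simpa [hpos.not_ge] using hr0
  rw [eLpNorm_eq_zero_iff hc.aestronglyMeasurable (by norm_num)] at h3
  exact Measure.eq_of_ae_eq h3 hc continuous_const

end Spectral

end SymmetricPair

/-! ### Fatou and Minkowski for `[0, ∞]`-valued functions. -/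

section Fatou

open Filter

variable {Ω : Type*} [MeasurableSpace Ω] {μ : Measure Ω}

/-- Fatou's lemma for `L^p` norms of functions with values in `[0, ∞]`. -/
theorem eLpNorm_liminf_le {a : ℕ → Ω → ℝ≥0∞} (ha : ∀ n, Measurable (a n)) (p : ℝ≥0∞) :
    eLpNorm (fun u => liminf (fun n => a n u) atTop) p μ ≤
      liminf (fun n => eLpNorm (a n) p μ) atTop := by
  by_cases hp0 : p = 0
  · simp [hp0]
  by_cases hp : p = ⊤
  · simp only [hp, eLpNorm_exponent_top, eLpNormEssSup_eq_essSup_enorm, enorm_eq_self]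
    exact ENNReal.essSup_liminf_le _
  have hpos : 0 < p.toReal := ENNReal.toReal_pos hp0 hp
  -- `x ↦ x ^ q` is an order isomorphism of `[0, ∞]`, so it commutes with `liminf`.
  have hpow : ∀ (q : ℝ), 0 < q → ∀ b : ℕ → ℝ≥0∞,
      liminf b atTop ^ q = liminf (fun n => b n ^ q) atTop := fun q hq b => by
    refine ((ENNReal.strictMono_rpow_of_pos hq).orderIsoOfSurjective _
      (ENNReal.rpow_left_bijective hq.ne').2).liminf_apply ?_ ?_ ?_ ?_
    all_goals isBoundedDefault
  simp only [eLpNorm_eq_lintegral_rpow_enorm_toReal hp0 hp, enorm_eq_self]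
  rw [← hpow _ (by positivity)]
  refine ENNReal.rpow_le_rpow ?_ (by positivity)
  simp only [hpow _ hpos]
  exact lintegral_liminf_le fun n => (ha n).pow_const _

theorem eLpNorm_le_of_le_liminf {G : Ω → ℝ≥0∞} {a : ℕ → Ω → ℝ≥0∞} (ha : ∀ n, Measurable (a n))
    {p B : ℝ≥0∞} (hG : ∀ u, G u ≤ liminf (fun n => a n u) atTop)
    (hB : ∀ n, eLpNorm (a n) p μ ≤ B) : eLpNorm G p μ ≤ B :=
  calc eLpNorm G p μ ≤ eLpNorm (fun u => liminf (fun n => a n u) atTop) p μ :=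
        eLpNorm_mono_enorm hG
    _ ≤ liminf (fun n => eLpNorm (a n) p μ) atTop := eLpNorm_liminf_le ha p
    _ ≤ liminf (fun _ : ℕ => B) atTop := liminf_le_liminf (Eventually.of_forall hB)
    _ = B := liminf_const B

/-- Minkowski's inequality for series of functions with values in `[0, ∞]`. -/
theorem eLpNorm_tsum_le {a : ℕ → Ω → ℝ≥0∞} (ha : ∀ n, Measurable (a n)) {p : ℝ≥0∞} (hp : 1 ≤ p) :
    eLpNorm (fun u => ∑' n, a n u) p μ ≤ ∑' n, eLpNorm (a n) p μ := by
  refine eLpNorm_le_of_le_liminf (a := fun n u => ∑ k ∈ Finset.range n, a k u)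
    (fun n => Finset.measurable_sum _ fun k _ => ha k)
    (fun u => (ENNReal.tendsto_nat_tsum fun n => a n u).liminf_eq.ge) fun n => ?_
  · rw [← Finset.sum_fn]
    exact (eLpNorm_sum_le (fun k _ => (ha k).aestronglyMeasurable) hp).trans
      (ENNReal.sum_le_tsum _)

theorem tsum_ofReal_pow_div_factorial {x : ℝ} (hx : 0 ≤ x) :
    ∑' k : ℕ, ENNReal.ofReal (x ^ k / k.factorial) = ENNReal.ofReal (Real.exp x) := by
  rw [← ENNReal.ofReal_tsum_of_nonneg (fun k => by positivity) (Real.summable_pow_div_factorial x),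
    Real.exp_eq_exp_ℝ, NormedSpace.exp_eq_tsum_div]

end Fatou

/-- Continuous functions with comparable oscillation differ by a bounded function. -/
theorem ComparableOscillation.exists_bound {ψ₁ ψ₂ : ℝ≥0 → ℝ} (h : ComparableOscillation ψ₁ ψ₂)
    (h₁ : Continuous ψ₁) (h₂ : Continuous ψ₂) : ∃ B : ℝ≥0, ∀ r, |ψ₂ r - ψ₁ r| ≤ B := by
  obtain ⟨R, -, C, hC, hb⟩ := h
  obtain ⟨D, hD⟩ := (isCompact_Icc (a := (0 : ℝ≥0)) (b := R)).exists_bound_of_continuousOn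
    (h₂.sub h₁).continuousOn
  refine ⟨(max C D).toNNReal, fun r => ?_⟩
  rw [Real.coe_toNNReal _ (hC.le.trans (le_max_left _ _))]
  rcases le_or_gt r R with hr | hr
  · exact (hD r ⟨zero_le, hr⟩).trans (le_max_right _ _)
  · rw [abs_sub_comm]
    exact (hb r hr).trans (le_max_left _ _)

namespace SymmetricPair

/-! ### Transfer of the maximal estimate. -/

section Transfer

open Filter Topology

set_option linter.unusedSectionVars false

variable {E : Type*} [NormedAddCommGroup E] [NormedSpace ℝ E]
  {U : Type*} [TopologicalSpace U] [ChartedSpace E U] [Group U] [LieGroup 𝓘(ℝ, E) ∞ U]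
  [CompactSpace U] [T2Space U] [MeasurableSpace U] [BorelSpace U]
  {μ : Measure U} [μ.IsHaarMeasure] [IsProbabilityMeasure μ]
  {S : SymmetricPair E U} {f : U → ℂ} {ψ₁ ψ₂ : ℝ≥0 → ℝ}

/-- Expanding `e^{-it(ψ₂ - ψ₁)}` into its Taylor series. -/
theorem hasSum_propagate_spectralSum (F : Finset ℝ≥0) (f : U → ℂ) (t : ℝ) (u : U) :
    HasSum (fun k : ℕ => (-Complex.I * t) ^ k / k.factorial * S.propagate μ ψ₁
        (S.spectralSum μ F (fun r => ((ψ₂ r - ψ₁ r : ℝ) : ℂ) ^ k) f) t u)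
      (S.propagate μ ψ₂ (S.spectralSum μ F 1 f) t u) := by
  simp only [propagate_spectralSum, Finset.mul_sum]
  refine hasSum_sum fun r _ => ?_
  have h := (NormedSpace.expSeries_div_hasSum_exp
    (-Complex.I * t * ((ψ₂ r - ψ₁ r : ℝ) : ℂ))).mul_right
      (Complex.exp (-Complex.I * t * ψ₁ r) * S.proj μ r f u)
  rw [← Complex.exp_eq_exp_ℂ, ← mul_assoc, ← Complex.exp_add] at h
  have e : Complex.exp (-Complex.I * t * ψ₂ r) * ((1 : ℝ≥0 → ℂ) r * S.proj μ r f u) =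
      Complex.exp (-Complex.I * t * ((ψ₂ r - ψ₁ r : ℝ) : ℂ) + -Complex.I * t * ψ₁ r) *
        S.proj μ r f u := by
    rw [Pi.one_apply, one_mul]
    congr 2
    push_cast
    ring
  rw [e]
  refine h.congr_fun fun k => ?_
  rw [mul_pow]
  ring

theorem maximalFunction_spectralSum_le (F : Finset ℝ≥0) (f : U → ℂ) (u : U) :
    S.maximalFunction μ ψ₂ (S.spectralSum μ F 1 f) u ≤
      ∑' k : ℕ, ENNReal.ofReal ((2 * Real.pi) ^ k / k.factorial) * S.maximalFunction μ ψ₁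
        (S.spectralSum μ F (fun r => ((ψ₂ r - ψ₁ r : ℝ) : ℂ) ^ k) f) u := by
  refine iSup₂_le fun t ht => ?_
  have h := hasSum_propagate_spectralSum (μ := μ) (S := S) (ψ₁ := ψ₁) (ψ₂ := ψ₂) F f t u
  refine (le_of_tendsto' h.enorm fun s => (enorm_sum_le _ _).trans
    (ENNReal.sum_le_tsum s)).trans (ENNReal.tsum_le_tsum fun k => ?_)
  rw [enorm_mul]
  refine mul_le_mul' ?_ (le_iSup₂ (f := fun t (_ : t ∈ Set.Ico (0 : ℝ) (2 * Real.pi)) =>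
    ‖S.propagate μ ψ₁ (S.spectralSum μ F _ f) t u‖ₑ) t ht)
  -- What is left is `|(-it)ᵏ/k!| ≤ (2π)ᵏ/k!`, from `0 ≤ t < 2π`.
  rw [← ofReal_norm]
  refine ENNReal.ofReal_le_ofReal ?_
  simp only [norm_div, norm_pow, norm_mul, norm_neg, Complex.norm_I, one_mul, Complex.norm_real,
    Complex.norm_natCast, Real.norm_eq_abs, abs_of_nonneg ht.1]
  gcongr
  exacts [ht.1, ht.2.le]

/-- The maximal estimate for `ψ₂` on finite spectral sums, with a constant that does not depend on
the number of summands. -/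
theorem eLpNorm_maximalFunction_spectralSum_le {B C : ℝ≥0} {p : ℝ≥0∞} {α : ℝ} (hp : 1 ≤ p)
    (hB : ∀ r, |ψ₂ r - ψ₁ r| ≤ B)
    (hC : ∀ f : U → ℂ, S.IsSmoothBiinvariant f →
      eLpNorm (S.maximalFunction μ ψ₁ f) p μ ≤ C * S.sobolevNorm μ α f)
    (hf : S.IsSmoothBiinvariant f) (F : Finset ℝ≥0) :
    eLpNorm (S.maximalFunction μ ψ₂ (S.spectralSum μ F 1 f)) p μ ≤
      ENNReal.ofReal (Real.exp (2 * Real.pi * B)) * C * S.sobolevNorm μ α f := by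
  set c : ℕ → ℝ≥0 → ℂ := fun k r => ((ψ₂ r - ψ₁ r : ℝ) : ℂ) ^ k with hc
  have hcB : ∀ k r, ‖c k r‖ₑ ≤ (B ^ k : ℝ≥0) := fun k r => by
    rw [enorm_le_coe, ← NNReal.coe_le_coe, coe_nnnorm]
    simp only [hc, norm_pow, Complex.norm_real, Real.norm_eq_abs, NNReal.coe_pow]
    gcongr
    exact hB r
  have hm : ∀ k, Measurable (S.maximalFunction μ ψ₁ (S.spectralSum μ F (c k) f)) := fun k =>
    measurable_maximalFunction_spectralSum _ _ _ _
  calc eLpNorm (S.maximalFunction μ ψ₂ (S.spectralSum μ F 1 f)) p μ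
      ≤ eLpNorm (fun u => ∑' k : ℕ, ENNReal.ofReal ((2 * Real.pi) ^ k / k.factorial) *
          S.maximalFunction μ ψ₁ (S.spectralSum μ F (c k) f) u) p μ :=
        eLpNorm_mono_enorm fun u => maximalFunction_spectralSum_le F f u
    _ ≤ ∑' k : ℕ, eLpNorm (fun u => ENNReal.ofReal ((2 * Real.pi) ^ k / k.factorial) *
          S.maximalFunction μ ψ₁ (S.spectralSum μ F (c k) f) u) p μ :=
        eLpNorm_tsum_le (fun k => (hm k).const_mul _) hp
    _ ≤ ∑' k : ℕ, ENNReal.ofReal ((2 * Real.pi * B) ^ k / k.factorial) *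
          (C * S.sobolevNorm μ α f) := by
        refine ENNReal.tsum_le_tsum fun k => ?_
        calc _ ≤ ENNReal.ofReal ((2 * Real.pi) ^ k / k.factorial) *
              eLpNorm (S.maximalFunction μ ψ₁ (S.spectralSum μ F (c k) f)) p μ := by
              exact eLpNorm_le_mul_eLpNorm_of_ae_le_mul'' p (hm k).aestronglyMeasurable
                (Eventually.of_forall fun u => le_rfl)
          -- The estimate for `ψ₁` is applied to the `k`-th multiplier image of `f`, again smooth
          -- and biinvariant, whose Sobolev norm grows by at most `Bᵏ`.
          _ ≤ ENNReal.ofReal ((2 * Real.pi) ^ k / k.factorial) *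
              (C * ((B ^ k : ℝ≥0) * S.sobolevNorm μ α f)) := by
              gcongr
              exact (hC _ (isSmoothBiinvariant_spectralSum hf F (c k))).trans
                (by gcongr; exact sobolevNorm_spectralSum_le F (c k) _ (hcB k) α f)
          _ = _ := by
              rw [mul_pow _ (B : ℝ), mul_div_right_comm, ENNReal.ofReal_mul (by positivity),
                ← NNReal.coe_pow, ENNReal.ofReal_coe_nnreal]
              ring
    _ = _ := by
        rw [ENNReal.tsum_mul_right, tsum_ofReal_pow_div_factorial (by positivity), ← mul_assoc]

/-- The propagator is the pointwise limit of the propagators of finite spectral sums wherever its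
defining series converges; no convergence has to be assumed for the inequality. -/
theorem maximalFunction_le_liminf {F : ℕ → Finset {r : ℝ≥0 | S.proj μ r f ≠ 0}}
    (hF : Tendsto F atTop atTop) (ψ : ℝ≥0 → ℝ) (u : U) :
    S.maximalFunction μ ψ f u ≤ liminf (fun n => S.maximalFunction μ ψ
      (S.spectralSum μ ((F n).map (Function.Embedding.subtype _)) 1 f) u) atTop := by
  refine iSup₂_le fun t ht => ?_
  by_cases hs : Summable fun r : ℝ≥0 => Complex.exp (-Complex.I * t * ψ r) * S.proj μ r f u
  · have h1 := (hasSum_subtype_iff_of_support_subset (s := {r : ℝ≥0 | S.proj μ r f ≠ 0})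
      fun r hr h0 => hr (by simp [h0])).2 hs.hasSum
    refine le_trans (h1.comp hF).enorm.liminf_eq.ge (liminf_le_liminf (Eventually.of_forall
      fun n => ?_))
    refine le_trans (le_of_eq ?_) (le_iSup₂ (f := fun t (_ : t ∈ Set.Ico (0 : ℝ) (2 * Real.pi)) =>
      ‖S.propagate μ ψ (S.spectralSum μ _ 1 f) t u‖ₑ) t ht)
    simp [propagate_spectralSum]
    rfl
  -- A divergent series has the default value `0`, which makes the bound trivial.
  · rw [propagate, tsum_eq_zero_of_not_summable hs, enorm_zero]
    exact zero_le

/-- The maximal estimate is stable under bounded perturbations of the symbol. -/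
theorem MaximalEstimate.of_bounded_sub {B : ℝ≥0} {p : ℝ≥0∞} {α : ℝ} (hp : 1 ≤ p)
    (hB : ∀ r, |ψ₂ r - ψ₁ r| ≤ B) (h : S.MaximalEstimate μ ψ₁ p α) :
    S.MaximalEstimate μ ψ₂ p α := by
  obtain ⟨C, hC0, hC⟩ := h
  refine ⟨(Real.exp (2 * Real.pi * B)).toNNReal * C,
    mul_pos (Real.toNNReal_pos.2 (Real.exp_pos _)) hC0, fun f hf => ?_⟩
  rw [ENNReal.coe_mul]
  -- If the Sobolev norm is infinite, so is the right-hand side, the constant being positive.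
  by_cases hfin : S.sobolevNorm μ α f = ⊤
  · rw [hfin, ENNReal.mul_top]
    · exact le_top
    · exact mul_ne_zero (by simpa using Real.exp_pos _) (by simpa using hC0.ne')
  have hcount := countable_support_proj hfin
  have : Countable {r : ℝ≥0 | S.proj μ r f ≠ 0} := hcount
  -- Countability of the index set makes `atTop` on its finite subsets countably generated, so a
  -- sequence exhausts it.
  obtain ⟨F, hF⟩ := exists_seq_tendsto (atTop : Filter (Finset {r : ℝ≥0 | S.proj μ r f ≠ 0}))
  refine eLpNorm_le_of_le_liminf
    (a := fun n => S.maximalFunction μ ψ₂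
      (S.spectralSum μ ((F n).map (Function.Embedding.subtype _)) 1 f))
    (fun n => measurable_maximalFunction_spectralSum _ _ _ _)
    (fun u => maximalFunction_le_liminf hF ψ₂ u)
    fun n => eLpNorm_maximalFunction_spectralSum_le hp hB hC hf _

theorem transferrableTo_of_bounded_sub {B : ℝ≥0} (hB : ∀ r, |ψ₂ r - ψ₁ r| ≤ B) :
    S.TransferrableTo μ ψ₁ ψ₂ :=
  fun _ _ _ hp h α hα => (h α hα).of_bounded_sub hp hB

end Transfer

end SymmetricPair

end SymmSpace

end

theorem theorem1p5 {E : Type*} [NormedAddCommGroup E] [NormedSpace ℝ E] [FiniteDimensional ℝ E]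
    {U : Type*} [TopologicalSpace U] [ChartedSpace E U] [Group U] [LieGroup 𝓘(ℝ, E) ∞ U]
    [CompactSpace U] [T2Space U] [MeasurableSpace U] [BorelSpace U]
    (μ : Measure U) [μ.IsHaarMeasure] [IsProbabilityMeasure μ]
    (S : SymmSpace.SymmetricPair E U) (hS : S.RankOne)
    (ψ₁ ψ₂ : ℝ≥0 → ℝ) (hψ₁ : Continuous ψ₁) (hψ₂ : Continuous ψ₂)
    (h : SymmSpace.ComparableOscillation ψ₁ ψ₂) :
    S.Transferrable μ ψ₁ ψ₂ := by
  obtain ⟨B, hB⟩ := h.exists_bound hψ₁ hψ₂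
  exact ⟨SymmSpace.SymmetricPair.transferrableTo_of_bounded_sub hB,
    SymmSpace.SymmetricPair.transferrableTo_of_bounded_sub
      fun r => abs_sub_comm (ψ₂ r) (ψ₁ r) ▸ hB r⟩
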